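/- For a domain $A$ let $A^+$ denote its absolute integral closure, that is, the integral closure of $A$ in an algebraic closure of its fraction field. A ring map $R \to S$ is quasi-finite if it is of finite type and has finite fibers on spectra. A map $M \to N$ of $R$-modules is pure if $M \otimes_R P \to N \otimes_R P$ is injective for every $R$-module $P$. A splinter is a Noetherian ring $R$ such that every finite ring map $R \to T$ inducing a surjection $\operatorname{Spec}(T) \to \operatorname{Spec}(R)$ has an $R$-linear left inverse. Let $R \hookrightarrow S$ be a quasi-finite extension of domains (not necessarily Noetherian) such that the induced map $\operatorname{Spec}(S) \to \operatorname{Spec}(R)$ is surjective, and suppose that $R$ is integrally closed in its fraction field. Then: 1. $S$ can be identified, as an $R$-algebra, with a subring of $\operatorname{Frac}(R^+)$. 2. For every ideal $I$ of $R$, $IS \cap R \subseteq IR^+ \cap R$. 3. For every ideal $I$ of $R$, $IS^+ \cap R = IR^+ \cap R$. 4. If $R$ is a splinter, then $R \to S$ is pure as a map of $R$-modules. -/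

import Mathlib

universe w u v v₁ v₂

/-- The absolute integral closure `R⁺` of a domain `R`: the integral closure of `R` in the
algebraic closure of its fraction field. -/
def AbsIntClosure (R : Type u) [CommRing R] [IsDomain R] : Type u :=
  integralClosure R (AlgebraicClosure (FractionRing R))

noncomputable instance (R : Type u) [CommRing R] [IsDomain R] : CommRing (AbsIntClosure R) :=
  inferInstanceAs (CommRing (integralClosure R (AlgebraicClosure (FractionRing R))))

instance (R : Type u) [CommRing R] [IsDomain R] : IsDomain (AbsIntClosure R) :=
  inferInstanceAs (IsDomain (integralClosure R (AlgebraicClosure (FractionRing R))))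

noncomputable instance (R : Type u) [CommRing R] [IsDomain R] : Algebra R (AbsIntClosure R) :=
  inferInstanceAs (Algebra R (integralClosure R (AlgebraicClosure (FractionRing R))))

/-- A map of `A`-modules `f : M → N` is pure (universally injective) if `M ⊗ P → N ⊗ P` is injective
for all `A`-modules `P`. The universe `w` of `P` is a parameter, so that it can be left arbitrary. -/
def IsPureMap {A : Type u} [CommRing A] {M : Type v₁} {N : Type v₂}
    [AddCommGroup M] [Module A M] [AddCommGroup N] [Module A N] (f : M →ₗ[A] N) : Prop :=
  ∀ (P : Type w) [AddCommGroup P] [Module A P], Function.Injective (f.rTensor P)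

/-- A splinter: a Noetherian ring `R` such that every finite ring map `R → T` that is surjective
on spectra has an `R`-linear left inverse. (A finite `R`-algebra is a quotient of a polynomial ring
in finitely many variables, so algebras in the universe of `R` are all of them up to
isomorphism.) -/
structure IsSplinter (R : Type u) [CommRing R] : Prop where
  isNoetherianRing : IsNoetherianRing R
  exists_leftInverse : ∀ (T : Type u) [CommRing T] [Algebra R T], Module.Finite R T →
    Function.Surjective (PrimeSpectrum.comap (algebraMap R T)) →
    ∃ g : T →ₗ[R] R, g ∘ₗ Algebra.linearMap R T = LinearMap.id

/-!
Write `B = R⁺` and let `Q` be a prime of `B`; choose a prime `q` of `S` over `Q ∩ R`. Zariski's main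
theorem provides `f ∉ q`, integral over `R`, such that `S[1/f]` is the localization at `f` of the
integral closure of `R` in `S`. Since `R` is normal, every root in `B` of the minimal polynomial of
`f` over `R` is the image of `f` under an `R`-embedding of `S` into `Frac B`, and some root lies
outside `Q`. The corresponding embedding maps `S` into `B_Q`. As `B_Q` is integrally closed in the
algebraically closed field `Frac B`, the embedding extends to `S⁺ → B_Q`.

Consequently, for every `R`-module `P`, an element `x ∈ P` that dies in `S ⊗ P` or in `S⁺ ⊗ P` dies
in `B_Q ⊗ P` for all `Q`, hence in `B ⊗ P`. Taking `P = R ⧸ I` gives the claims on ideals, and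
purity follows because a splinter is pure in `B`.
-/

open Polynomial TensorProduct

section Roots

lemma isWeaklyEisensteinAt_of_splits_of_roots_mem {A : Type*} [CommRing A] [IsDomain A] {g : A[X]}
    (hsplits : g.Splits) (hmonic : g.Monic) {Q : Ideal A} (hroots : ∀ a ∈ g.roots, a ∈ Q) :
    g.IsWeaklyEisensteinAt Q := by
  rw [hsplits.eq_prod_roots_of_monic hmonic]
  refine Multiset.prod_induction (IsWeaklyEisensteinAt · Q) _ (fun _ _ ↦ .mul) ⟨by simp⟩ ?_
  simp only [Multiset.mem_map]
  rintro _ ⟨a, ha, rfl⟩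
  exact ⟨fun hn ↦ by simp_all⟩

lemma exists_aeval_eq_zero_notMem_of_splits {R S B : Type*} [CommRing R] [CommRing S] [Algebra R S]
    [CommRing B] [IsDomain B] [Algebra R B] {g : R[X]} (hmonic : g.Monic)
    (hsplits : (g.map (algebraMap R B)).Splits) {q : Ideal S} [q.IsPrime] {Q : Ideal B}
    (hQq : Q.under R ≤ q.under R) {f : S} (hf : aeval f g = 0) (hfq : f ∉ q) :
    ∃ b : B, aeval b g = 0 ∧ b ∉ Q := by
  -- Otherwise `g` reduces to a power of `X` modulo `Q ∩ R`, hence modulo `q`, which forces `f ∈ q`.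
  by_contra! hroots
  have hgB : (g.map (algebraMap R B)).IsWeaklyEisensteinAt Q :=
    isWeaklyEisensteinAt_of_splits_of_roots_mem hsplits (hmonic.map _) fun b hb ↦
      hroots b ((mem_aroots'.mp hb).2)
  have hg : g.IsWeaklyEisensteinAt (q.under R) := ⟨fun {n} hn ↦ hQq <| by
    simpa only [Ideal.mem_comap, coeff_map] using
      hgB.mem (n := n) (by rwa [hmonic.natDegree_map])⟩
  have hpow := hg.pow_natDegree_le_of_aeval_zero_of_monic_mem_map hf hmonic _ le_rfl
  exact hfq (‹q.IsPrime›.mem_of_pow_mem _ (Ideal.map_comap_le hpow))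

lemma splits_of_monic_of_isIntegrallyClosedIn {C : Type*} (L : Type*) [CommRing C] [IsDomain C]
    [Field L] [IsAlgClosed L] [Algebra C L] [IsIntegrallyClosedIn C L] {g : C[X]}
    (hmonic : g.Monic) : g.Splits :=
  (IsAlgClosed.splits (g.map (algebraMap C L))).of_splits_map_of_injective
    (IsIntegralClosure.algebraMap_injective C C L) fun _ hx ↦
      IsIntegrallyClosedIn.isIntegral_iff.mp ⟨g, hmonic, (mem_aroots'.mp hx).2⟩

end Roots

section Embeddings

lemma nonempty_algHom_of_forall_mem_range {R A C L : Type*} [CommRing R] [CommRing A] [Algebra R A]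
    [CommRing C] [Algebra R C] [CommRing L] [Algebra R L] [Algebra C L] [IsScalarTower R C L]
    [FaithfulSMul C L] (φ : A →ₐ[R] L) (hφ : ∀ a, φ a ∈ (algebraMap C L).range) :
    Nonempty (A →ₐ[R] C) :=
  let i := IsScalarTower.toAlgHom R C L
  ⟨(AlgEquiv.ofInjective i (FaithfulSMul.algebraMap_injective C L)).symm.toAlgHom.comp
    (φ.codRestrict i.range hφ)⟩

lemma algHom_injective_of_isAlgebraic {R S C : Type*} [CommRing R] [CommRing S] [IsDomain S]
    [Algebra R S] [Algebra.IsAlgebraic R S] [CommRing C] [Algebra R C] [FaithfulSMul R C]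
    (φ : S →ₐ[R] C) : Function.Injective φ := by
  rw [injective_iff_map_eq_zero]
  by_contra! ⟨s, hφs, hs⟩
  obtain ⟨r, hr, a, ha⟩ := (Algebra.IsAlgebraic.isAlgebraic (R := R) s).exists_nonzero_dvd
    (mem_nonZeroDivisors_of_ne_zero hs)
  refine hr ((FaithfulSMul.algebraMap_eq_zero_iff R C).mp ?_)
  rw [← φ.commutes, ha, map_mul, hφs, zero_mul]

lemma nonempty_algHom_of_isIntegral {A T C : Type*} (L : Type*) [CommRing A] [CommRing T]
    [IsDomain T] [Algebra A T] [FaithfulSMul A T] [Algebra.IsIntegral A T] [CommRing C]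
    [Algebra A C] [FaithfulSMul A C] [Field L] [IsAlgClosed L] [Algebra C L]
    [IsIntegrallyClosedIn C L] : Nonempty (T →ₐ[A] C) := by
  have : FaithfulSMul C L := (faithfulSMul_iff_algebraMap_injective C L).mpr
    (IsIntegralClosure.algebraMap_injective C C L)
  let := Algebra.compHom L (algebraMap A C)
  have : IsScalarTower A C L := .of_algebraMap_eq fun _ ↦ rfl
  have : FaithfulSMul A L := .trans A C L
  have : IsDomain A := (FaithfulSMul.algebraMap_injective A T).isDomain
  let φ : T →ₐ[A] L := IsAlgClosed.lift
  exact nonempty_algHom_of_forall_mem_range φ fun t ↦ IsIntegrallyClosedIn.isIntegral_iff.mp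
    ((Algebra.IsIntegral.isIntegral (R := A) t).map φ).tower_top

lemma exists_algHom_apply_eq_of_aeval_minpoly_eq_zero {R S L : Type*} [CommRing R] [IsDomain R]
    [IsIntegrallyClosed R] [CommRing S] [IsDomain S] [Algebra R S] [FaithfulSMul R S]
    [Algebra.IsAlgebraic R S] [Field L] [IsAlgClosed L] [Algebra R L] [FaithfulSMul R L] {f : S}
    (hf : IsIntegral R f) {y : L} (hy : aeval y (minpoly R f) = 0) :
    ∃ φ : S →ₐ[R] L, φ f = y := by
  let := FractionRing.liftAlgebra R L
  let := FractionRing.liftAlgebra R (FractionRing S)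
  have hminpoly := minpoly.isIntegrallyClosed_eq_field_fractions (FractionRing R)
    (FractionRing S) hf
  obtain ⟨φ, hφ⟩ := IntermediateField.exists_algHom_of_splits_of_aeval
    (F := FractionRing R) (E := FractionRing S) (x := algebraMap S (FractionRing S) f) (y := y)
    (fun x ↦ ⟨Algebra.IsIntegral.isIntegral x, IsAlgClosed.splits _⟩)
    (by rw [hminpoly, aeval_map_algebraMap, hy])
  exact ⟨(φ.restrictScalars R).comp (IsScalarTower.toAlgHom R S (FractionRing S)), hφ⟩

lemma isAlgebraic_of_quasiFinite (R S : Type*) [CommRing R] [IsDomain R] [CommRing S]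
    [IsDomain S] [Algebra R S] [FaithfulSMul R S] [Algebra.QuasiFinite R S] :
    Algebra.IsAlgebraic R S := by
  let := FractionRing.liftAlgebra R (FractionRing S)
  have : Algebra.QuasiFinite R (FractionRing S) := .of_isLocalization (S := S) (nonZeroDivisors S)
  have : Algebra.QuasiFinite (FractionRing R) (FractionRing S) := .of_restrictScalars R _ _
  have : Module.Finite (FractionRing R) (FractionRing S) := .of_quasiFinite
  have : Algebra.IsAlgebraic R (FractionRing S) :=
    (IsFractionRing.comap_isAlgebraic_iff (K := FractionRing R)).mpr inferInstance
  exact .of_injective (IsScalarTower.toAlgHom R S (FractionRing S)) (IsFractionRing.injective S _)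

end Embeddings

section OneTmul

lemma one_tmul_eq_zero_of_algHom {R A B P : Type*} [CommRing R] [CommRing A] [Algebra R A]
    [CommRing B] [Algebra R B] [AddCommGroup P] [Module R P] (φ : A →ₐ[R] B) {x : P}
    (hx : (1 : A) ⊗ₜ[R] x = 0) : (1 : B) ⊗ₜ[R] x = 0 := by
  simpa using congr(φ.toLinearMap.rTensor P $hx)

lemma one_tmul_eq_zero_of_forall_algHom_localizationAtPrime {R T B P : Type*} [CommRing R]
    [CommRing T] [Algebra R T] [CommRing B] [Algebra R B] [AddCommGroup P] [Module R P]
    (h : ∀ (Q : Ideal B) [Q.IsMaximal], Nonempty (T →ₐ[R] Localization.AtPrime Q)) {x : P}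
    (hx : (1 : T) ⊗ₜ[R] x = 0) : (1 : B) ⊗ₜ[R] x = 0 := by
  refine Module.eq_zero_of_localization_maximal _ (fun Q _ ↦
    AlgebraTensorModule.rTensor R P (Algebra.linearMap B (Localization.AtPrime Q))) _ fun Q _ ↦ ?_
  obtain ⟨φ⟩ := h Q
  simpa using one_tmul_eq_zero_of_algHom φ hx

lemma mem_comap_map_iff_one_tmul_eq_zero {R A : Type*} [CommRing R] [CommRing A] [Algebra R A]
    {I : Ideal R} {a : R} :
    a ∈ (I.map (algebraMap R A)).comap (algebraMap R A) ↔
      (1 : A) ⊗ₜ[R] Ideal.Quotient.mk I a = 0 := by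
  have htmul : (1 : A) ⊗ₜ[R] Ideal.Quotient.mk I a =
      Algebra.TensorProduct.quotIdealMapEquivTensorQuot A I (algebraMap R A a) := by
    rw [Algebra.TensorProduct.quotIdealMapEquivTensorQuot_mk, Algebra.algebraMap_eq_smul_one,
      smul_tmul, Algebra.smul_def, mul_one, Ideal.Quotient.algebraMap_eq]
  rw [htmul, EmbeddingLike.map_eq_zero_iff, Ideal.mem_comap, Ideal.Quotient.eq_zero_iff_mem]

end OneTmul

section QuasiFinite

variable {R S B : Type*} [CommRing R] [IsDomain R] [IsIntegrallyClosed R] [CommRing S] [IsDomain S]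
  [Algebra R S] [FaithfulSMul R S] [Algebra.FiniteType R S] [Algebra.QuasiFinite R S] [CommRing B]
  [IsDomain B] [IsIntegrallyClosed B] [IsAlgClosed (FractionRing B)] [Algebra R B]
  [FaithfulSMul R B]

theorem nonempty_algHom_localizationAtPrime_of_quasiFinite {q : Ideal S} [q.IsPrime] {Q : Ideal B}
    [Q.IsPrime] (hQq : Q.under R ≤ q.under R) : Nonempty (S →ₐ[R] Localization.AtPrime Q) := by
  let L := FractionRing B
  have : FaithfulSMul R L := .trans R B L
  have : Algebra.IsAlgebraic R S := isAlgebraic_of_quasiFinite R S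
  obtain ⟨f, hfq, hf, hfS⟩ := Algebra.zariskisMainProperty_iff.mp
    (Algebra.ZariskisMainProperty.of_finiteType (R := R) q)
  have hmonic : (minpoly R f).Monic := minpoly.monic hf
  obtain ⟨b, hb, hbQ⟩ := exists_aeval_eq_zero_notMem_of_splits hmonic
    (splits_of_monic_of_isIntegrallyClosedIn L (hmonic.map (algebraMap R B))) hQq
    (minpoly.aeval R f) hfq
  obtain ⟨φ, hφ⟩ := exists_algHom_apply_eq_of_aeval_minpoly_eq_zero (L := L) hf
    (y := algebraMap B L b) (by rw [aeval_algebraMap_apply, hb, map_zero])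
  have : IsScalarTower R (Localization.AtPrime Q) L := .to₁₃₄ R B _ L
  -- `φ s = φ (f ^ m * s) / b ^ m`, where `f ^ m * s` is integral over `R`.
  refine nonempty_algHom_of_forall_mem_range φ fun s ↦ ?_
  obtain ⟨m, hm⟩ := hfS s
  obtain ⟨c, hc⟩ : ∃ c : B, algebraMap B L c = algebraMap B L (b ^ m) * φ s := by
    rw [map_pow, ← hφ, ← map_pow, ← map_mul]
    exact IsIntegrallyClosed.isIntegral_iff.mp (hm.map φ).tower_top
  have hbm : b ^ m ∈ Q.primeCompl := pow_mem (S := Q.primeCompl) hbQ m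
  have hbm0 : algebraMap B L (b ^ m) ≠ 0 :=
    IsFractionRing.to_map_ne_zero_of_mem_nonZeroDivisors (Q.primeCompl_le_nonZeroDivisors hbm)
  refine ⟨IsLocalization.mk' _ c ⟨b ^ m, hbm⟩, mul_left_cancel₀ hbm0 ?_⟩
  rw [← hc, IsScalarTower.algebraMap_apply B (Localization.AtPrime Q) L, ← map_mul,
    IsLocalization.mk'_spec'_mk, ← IsScalarTower.algebraMap_apply]

theorem nonempty_algHom_localizationAtPrime_of_isIntegral_of_quasiFinite {T : Type*} [CommRing T]
    [IsDomain T] [Algebra R T] [Algebra S T] [IsScalarTower R S T] [FaithfulSMul S T]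
    [Algebra.IsIntegral S T] {q : Ideal S} [q.IsPrime] {Q : Ideal B} [Q.IsPrime]
    (hQq : Q.under R ≤ q.under R) : Nonempty (T →ₐ[R] Localization.AtPrime Q) := by
  have : Algebra.IsAlgebraic R S := isAlgebraic_of_quasiFinite R S
  have : FaithfulSMul R (Localization.AtPrime Q) := .trans R B _
  have : IsIntegrallyClosed (Localization.AtPrime Q) :=
    isIntegrallyClosed_of_isLocalization _ Q.primeCompl Q.primeCompl_le_nonZeroDivisors
  obtain ⟨φ⟩ := nonempty_algHom_localizationAtPrime_of_quasiFinite hQq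
  let := φ.toRingHom.toAlgebra
  have : IsScalarTower R S (Localization.AtPrime Q) := .of_algHom φ
  have : FaithfulSMul S (Localization.AtPrime Q) :=
    (faithfulSMul_iff_algebraMap_injective _ _).mpr (algHom_injective_of_isAlgebraic φ)
  obtain ⟨ψ⟩ := nonempty_algHom_of_isIntegral (A := S) (T := T) (C := Localization.AtPrime Q)
    (FractionRing B)
  exact ⟨ψ.restrictScalars R⟩

theorem one_tmul_eq_zero_of_isIntegral_of_quasiFinite
    (hspec : Function.Surjective (PrimeSpectrum.comap (algebraMap R S))) {T P : Type*} [CommRing T]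
    [IsDomain T] [Algebra R T] [Algebra S T] [IsScalarTower R S T] [FaithfulSMul S T]
    [Algebra.IsIntegral S T] [AddCommGroup P] [Module R P] {x : P} (hx : (1 : T) ⊗ₜ[R] x = 0) :
    (1 : B) ⊗ₜ[R] x = 0 := by
  refine one_tmul_eq_zero_of_forall_algHom_localizationAtPrime (fun Q _ ↦ ?_) hx
  obtain ⟨q, hq⟩ := hspec ⟨Q.under R, inferInstance⟩
  exact nonempty_algHom_localizationAtPrime_of_isIntegral_of_quasiFinite (S := S)
    congr(($hq).asIdeal).ge

end QuasiFinite

section Purity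

lemma isPureMap_linearMap_iff {R : Type u} {A : Type v} [CommRing R] [CommRing A] [Algebra R A] :
    IsPureMap.{w} (Algebra.linearMap R A) ↔
      ∀ (P : Type w) [AddCommGroup P] [Module R P] (x : P), (1 : A) ⊗ₜ[R] x = 0 → x = 0 := by
  refine forall₃_congr fun P _ _ ↦ ?_
  rw [injective_iff_map_eq_zero, (TensorProduct.lid R P).symm.surjective.forall]
  simp

theorem IsSplinter.isPureMap_linearMap_of_isIntegral {R B : Type u} [CommRing R]
    (hR : IsSplinter R) [CommRing B] [Algebra R B] [FaithfulSMul R B] [Algebra.IsIntegral R B] :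
    IsPureMap.{w} (Algebra.linearMap R B) := by
  refine isPureMap_linearMap_iff.mpr fun P _ _ x hx ↦ ?_
  obtain ⟨A, hbot, hA, hxA⟩ := TensorProduct.Algebra.eq_of_fg_of_subtype_eq Subalgebra.fg_bot
    (t := (1 : (⊥ : Subalgebra R B)) ⊗ₜ[R] x) (t' := 0) (by simpa using hx)
  replace hxA : (1 : A) ⊗ₜ[R] x = 0 := by simpa using hxA
  have : Algebra.FiniteType R A := A.fg_iff_finiteType.mp hA
  have : Algebra.IsIntegral R A := .of_injective A.val Subtype.val_injective
  have : FaithfulSMul R A := .tower_bot R A B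
  have : Module.Finite R A := Algebra.IsIntegral.finite
  obtain ⟨g, hg⟩ := hR.exists_leftInverse A inferInstance (Algebra.IsIntegral.comap_surjective R A)
  have hg1 : g 1 = 1 := by simpa using LinearMap.congr_fun hg 1
  simpa [hg1] using congr(TensorProduct.lid R P (g.rTensor P $hxA))

end Purity

namespace AbsIntClosure

variable (R : Type*) [CommRing R] [IsDomain R]

instance : FaithfulSMul R (AbsIntClosure R) := by
  have : FaithfulSMul R (AlgebraicClosure (FractionRing R)) := .trans R (FractionRing R) _
  exact inferInstanceAs (FaithfulSMul R (integralClosure R (AlgebraicClosure (FractionRing R))))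

instance : Algebra.IsIntegral R (AbsIntClosure R) :=
  inferInstanceAs (Algebra.IsIntegral R (integralClosure R (AlgebraicClosure (FractionRing R))))

instance : IsIntegrallyClosed (AbsIntClosure R) :=
  IsIntegrallyClosed.of_isIntegrallyClosedIn
    (integralClosure R (AlgebraicClosure (FractionRing R))) (AlgebraicClosure (FractionRing R))

instance : IsAlgClosed (FractionRing (AbsIntClosure R)) := by
  let L := AlgebraicClosure (FractionRing R)
  have : FaithfulSMul R L := .trans R (FractionRing R) _
  have : Algebra.IsAlgebraic R L :=
    (IsFractionRing.comap_isAlgebraic_iff (K := FractionRing R)).mpr inferInstance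
  have : IsFractionRing (integralClosure R L) L :=
    integralClosure.isFractionRing_of_algebraic fun x hx ↦
      (FaithfulSMul.algebraMap_eq_zero_iff R L).mp hx
  exact .of_ringEquiv L _ (FractionRing.algEquiv (integralClosure R L) L).symm.toRingEquiv

end AbsIntClosure

theorem mainTheorem7 {R : Type u} {S : Type v} [CommRing R] [IsDomain R]
    [IsIntegrallyClosed R] [CommRing S] [IsDomain S] [Algebra R S]
    [Algebra.FiniteType R S] [Algebra.QuasiFinite R S]
    (hinj : Function.Injective (algebraMap R S))
    (hspec : Function.Surjective (PrimeSpectrum.comap (algebraMap R S))) :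
    (∃ φ : S →ₐ[R] FractionRing (AbsIntClosure R), Function.Injective φ) ∧
    (∀ I : Ideal R,
      (I.map (algebraMap R S)).comap (algebraMap R S) ≤
        (I.map (algebraMap R (AbsIntClosure R))).comap (algebraMap R (AbsIntClosure R))) ∧
    (∀ I : Ideal R,
      (I.map ((algebraMap S (AbsIntClosure S)).comp (algebraMap R S))).comap
          ((algebraMap S (AbsIntClosure S)).comp (algebraMap R S)) =
        (I.map (algebraMap R (AbsIntClosure R))).comap (algebraMap R (AbsIntClosure R))) ∧
    (IsSplinter R → IsPureMap.{w} (Algebra.linearMap R S)) := by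
  have : FaithfulSMul R S := (faithfulSMul_iff_algebraMap_injective R S).mpr hinj
  let := Algebra.compHom (AbsIntClosure S) (algebraMap R S)
  have : IsScalarTower R S (AbsIntClosure S) := .of_algebraMap_eq fun _ ↦ rfl
  have : FaithfulSMul R (AbsIntClosure S) := .trans R S _
  refine ⟨?_, fun I a ha ↦ ?_, fun I ↦ Ideal.ext fun a ↦ ?_, fun hR ↦ ?_⟩
  · have := isAlgebraic_of_quasiFinite R S
    have : FaithfulSMul R (FractionRing (AbsIntClosure R)) := .trans R (AbsIntClosure R) _
    exact ⟨IsAlgClosed.lift, algHom_injective_of_isAlgebraic _⟩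
  · rw [mem_comap_map_iff_one_tmul_eq_zero] at ha ⊢
    exact one_tmul_eq_zero_of_isIntegral_of_quasiFinite (T := S) hspec ha
  · refine mem_comap_map_iff_one_tmul_eq_zero.trans
      (.trans ⟨fun ha ↦ ?_, fun ha ↦ ?_⟩ mem_comap_map_iff_one_tmul_eq_zero.symm)
    · exact one_tmul_eq_zero_of_isIntegral_of_quasiFinite hspec ha
    · obtain ⟨ψ⟩ := nonempty_algHom_of_isIntegral (A := R) (T := AbsIntClosure R)
        (C := AbsIntClosure S) (FractionRing (AbsIntClosure S))
      exact one_tmul_eq_zero_of_algHom ψ ha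
  · have hpure := hR.isPureMap_linearMap_of_isIntegral (B := AbsIntClosure R)
    rw [isPureMap_linearMap_iff] at hpure ⊢
    exact fun P _ _ x hx ↦
      hpure P x (one_tmul_eq_zero_of_isIntegral_of_quasiFinite (T := S) hspec hx)
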